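/- Let $k$ be a field with algebraic closure $\overline k$, and let $F\in k[X_0,X_1,X_2]$ be homogeneous of degree $f$ and reduced (squarefree over $\overline k$). Let $C=V(F)\subset\mathbb P^2_{\overline k}$. For a point $P\in C$ write a local equation of $C$ at $P$, with $P$ at the origin, as $\varphi(x,y)=\sum_i\varphi_{(i)}$ with $\varphi_{(i)}$ homogeneous of degree $i$. A singular point $P$ of $C$ is called admissible if it is of one of the following types: - $R_m$ for some $m\ge 2$: $\varphi_{(i)}=0$ for $i<m$, and $\varphi_{(m)}$ is a product of $m$ pairwise non-proportional nonzero linear forms over $\overline k$; - $D_m$ for some $m$: $\varphi_{(0)}=\varphi_{(1)}=0$, $\varphi_{(2)}=L^2$ for a nonzero linear form $L$, $L^2\mid\varphi_{(i)}$ for $2\le i\le m-1$, and $L\nmid\varphi_{(m)}$. Let $\delta(P)=\dim_{\overline k}\widetilde{\mathcal O}_{C,P}/\mathcal O_{C,P}$, where $\widetilde{\mathcal O}_{C,P}$ is the integral closure of the local ring $\mathcal O_{C,P}$ in its total ring of fractions, and let $g=\binom{f-1}{2}-\sum_P\delta(P)$ be the geometric genus of the normalization of $C$. Suppose that all singular points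 of $C$ are admissible, that $g$ is a non-negative integer, and that $F=HK$ with $H,K\in\overline k[X_0,X_1,X_2]$ and $h=\deg H\le\deg K$. 1. If $5\le f\le 10$ and $4\le g\le 14$, then $h$ is at most the entry in row $f$ and column $g$ of the following table. Here "$-$" means that $h=0$ (there is no factor of positive degree), and "$*$" means that no such curve exists. $$\begin{array}{r|ccccccccccc} & g=4&5&6&7&8&9&10&11&12&13&14\\ \hline f=5&-&-&-&*&*&*&*&*&*&*&*\\ 6&1&1&-&-&-&-&-&*&*&*&*\\ 7&2&2&1&1&1&1&-&-&-&-&-\\ 8&4&4&3&2&2&2&1&1&1&1&1\\ 9&4&4&4&4&4&3&3&2&2&2&2\\ 10&5&5&5&5&5&5&5&5&4&3&3 \end{array}$$ 2. If ($f\le 7$ and $g\ge 4$), or ($f=8$ and $g\ge 7$), or ($f=9$ and $g\ge 11$), then $h\le 2$; that is, in every factorization $F=HK$ the factor of smaller degree has degree at most $2$. -/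

import Mathlib

open scoped LinearAlgebra.Projectivization

namespace PlaneCurve

noncomputable section

/-- An index of a nonzero homogeneous coordinate of the point `P` of the projective plane. -/
def chartIndex {L : Type*} [Field L] (P : ℙ L (Fin 3 → L)) : Fin 3 :=
  (Function.ne_iff.mp P.rep_nonzero).choose

/-- The local equation `f(x, y)` of the plane curve `V(F)` at the point `P`, in the standard affine
chart around `P`, translated so that `P` corresponds to `(0, 0)`. If `v` represents `P` and
`v i ≠ 0`, this is `F (v + x • e (i+1) + y • e (i+2))`, with indices modulo 3. -/
def localEquation {L : Type*} [Field L] (F : MvPolynomial (Fin 3) L) (P : ℙ L (Fin 3 → L)) :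
    MvPolynomial (Fin 2) L :=
  MvPolynomial.aeval
    (fun j : Fin 3 =>
      MvPolynomial.C (P.rep j)
        + (if j = chartIndex P + 1 then MvPolynomial.X 0 else 0)
        + (if j = chartIndex P + 2 then MvPolynomial.X 1 else 0)) F

/-- `P` is a singular point of `V(F)`: the form `F` and all its partial derivatives vanish
at `P`. -/
def IsSingularPoint {L : Type*} [Field L] (F : MvPolynomial (Fin 3) L)
    (P : ℙ L (Fin 3 → L)) : Prop :=
  MvPolynomial.eval P.rep F = 0 ∧ ∀ i, MvPolynomial.eval P.rep (MvPolynomial.pderiv i F) = 0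

/-- The origin is a regular `m`-fold point of `f(x, y) = 0` (type `R_m`), `m ≥ 2`: the homogeneous
parts of `f` of degree less than `m` vanish, and the part of degree `m` is a product of `m`
nonzero linear forms, no two of which are proportional. -/
def IsRegularMultiplePoint {L : Type*} [Field L] (m : ℕ) (f : MvPolynomial (Fin 2) L) : Prop :=
  2 ≤ m ∧ (∀ i < m, MvPolynomial.homogeneousComponent i f = 0) ∧
    ∃ l : Fin m → MvPolynomial (Fin 2) L,
      (∀ i, (l i).IsHomogeneous 1 ∧ l i ≠ 0) ∧
      (∀ i j, i ≠ j → ¬ Associated (l i) (l j)) ∧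
      MvPolynomial.homogeneousComponent m f = ∏ i, l i

/-- The origin is a double point of index `m` of `f(x, y) = 0` (type `D_m`): writing `f` as the sum
of its homogeneous parts `f_i`, one has `f_0 = f_1 = 0`, `f_2 = l ^ 2` for a nonzero linear form
`l`, `l ^ 2 ∣ f_i` for `2 ≤ i ≤ m - 1`, and `l ∤ f_m`. (This forces `m ≥ 3`.) -/
def IsDoublePointOfIndex {L : Type*} [Field L] (m : ℕ) (f : MvPolynomial (Fin 2) L) : Prop :=
  MvPolynomial.homogeneousComponent 0 f = 0 ∧ MvPolynomial.homogeneousComponent 1 f = 0 ∧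
    ∃ l : MvPolynomial (Fin 2) L, l.IsHomogeneous 1 ∧ l ≠ 0 ∧
      MvPolynomial.homogeneousComponent 2 f = l ^ 2 ∧
      (∀ i, 2 ≤ i → i < m → l ^ 2 ∣ MvPolynomial.homogeneousComponent i f) ∧
      ¬ l ∣ MvPolynomial.homogeneousComponent m f

/-- `P` is an admissible singularity of `V(F)`: of type `R_m` or `D_m` for some `m`. -/
def IsAdmissible {L : Type*} [Field L] (F : MvPolynomial (Fin 3) L)
    (P : ℙ L (Fin 3 → L)) : Prop :=
  (∃ m, IsRegularMultiplePoint m (localEquation F P)) ∨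
    ∃ m, IsDoublePointOfIndex m (localEquation F P)

/-- The maximal ideal `(x, y)` of the origin in the affine plane. -/
abbrev originIdeal (L : Type*) [Field L] : Ideal (MvPolynomial (Fin 2) L) :=
  RingHom.ker (MvPolynomial.constantCoeff : MvPolynomial (Fin 2) L →+* L)

instance originIdeal_isPrime (L : Type*) [Field L] : (originIdeal L).IsPrime :=
  RingHom.ker_isPrime _

/-- The local ring of the affine plane at the origin. -/
abbrev PlaneLocalRing (L : Type*) [Field L] : Type _ :=
  Localization.AtPrime (originIdeal L)

/-- The local ring `L[x, y]_{(x, y)} / (f)` of the affine curve `f(x, y) = 0` at the origin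
(the zero ring if the curve does not pass through the origin). -/
abbrev CurveLocalRing {L : Type*} [Field L] (f : MvPolynomial (Fin 2) L) : Type _ :=
  PlaneLocalRing L ⧸ Ideal.span {algebraMap (MvPolynomial (Fin 2) L) (PlaneLocalRing L) f}

/-- The normalization of a (reduced) ring: its integral closure in its total ring of fractions. -/
abbrev Normalization (O : Type*) [CommRing O] : Subalgebra O (FractionRing O) :=
  integralClosure O (FractionRing O)

/-- The delta invariant of an `L`-algebra `O`: the dimension over `L` (possibly `⊤`) of the
quotient of the normalization of `O` by `O` itself. -/
def deltaInvariant (L O : Type*) [Field L] [CommRing O] [Algebra L O] : ℕ∞ :=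
  Cardinal.toENat (Module.rank L
    (Normalization O ⧸ LinearMap.range (Algebra.linearMap O (Normalization O))))

/-- The delta invariant of the affine curve `f(x, y) = 0` at the origin. -/
def localDelta {L : Type*} [Field L] (f : MvPolynomial (Fin 2) L) : ℕ∞ :=
  deltaInvariant L (CurveLocalRing f)

/-- The amount `δ(P)` by which the point `P` drops the genus of `V(F)`. -/
def delta {L : Type*} [Field L] (F : MvPolynomial (Fin 3) L) (P : ℙ L (Fin 3 → L)) : ℕ∞ :=
  localDelta (localEquation F P)

/-- `g` is the geometric genus of (the normalization of) the plane curve `V(F)` of degree `f`: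
`g = (f-1)(f-2)/2 - ∑ P, δ(P)`. The summand vanishes at all nonsingular points. -/
def HasGeometricGenus {L : Type*} [Field L] (F : MvPolynomial (Fin 3) L) (f g : ℕ) : Prop :=
  (g : ℕ∞) + ∑' P : ℙ L (Fin 3 → L), delta F P = (((f - 1).choose 2 : ℕ) : ℕ∞)

/-- The rows of the table of maximal factor degrees for `f = 5, …, 10`, with columns
`g = 4, …, 14`. The entry `some b` with `b ≥ 1` is the bound `b`, the entry `some 0` (a dash in the
table) says that there is no factor of positive degree, and `none` (a star in the table) that
there is no curve with these `f` and `g`. -/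
def tableRow : ℕ → List (Option ℕ)
  | 5  => [some 0, some 0, some 0, none, none, none, none, none, none, none, none]
  | 6  => [some 1, some 1, some 0, some 0, some 0, some 0, some 0, none, none, none, none]
  | 7  => [some 2, some 2, some 1, some 1, some 1, some 1, some 0, some 0, some 0, some 0, some 0]
  | 8  => [some 4, some 4, some 3, some 2, some 2, some 2, some 1, some 1, some 1, some 1, some 1]
  | 9  => [some 4, some 4, some 4, some 4, some 4, some 3, some 3, some 2, some 2, some 2, some 2]
  | 10 => [some 5, some 5, some 5, some 5, some 5, some 5, some 5, some 5, some 4, some 3, some 3]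
  | _  => []

/-- The entry of the table in row `f` and column `g`. -/
def tableEntry (f g : ℕ) : Option ℕ :=
  (tableRow f).getD (g - 4) none

/-- The cases of interest. -/
def CaseOfInterest (f g : ℕ) : Prop :=
  (f ≤ 7 ∧ 4 ≤ g) ∨ (f = 8 ∧ 7 ≤ g) ∨ (f = 9 ∧ 11 ≤ g)

end

end PlaneCurve

/-!
The point is the inequality `∑ P, δ(P) ≥ deg H * deg K` for a factorization `F = H * K`
(`mul_le_tsum_delta`). With `h + k = f` it gives
`g ≤ (f - 1).choose 2 - h * k = (h - 1).choose 2 + (k - 1).choose 2 - 1` when `h, k ≥ 1`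
(`genus_add_mul_le`), and the table merely lists, for each `f` and `g`, the largest `h ≤ f / 2`
which this leaves possible; for `h = 0` it reads `g ≤ (f - 1).choose 2`.

The inequality has a local and a global half.

* Locally, let `a`, `b` be the equations of `H`, `K` in the local ring `O` of the plane at `P`. They
  are coprime, so `a + b` is a nonzerodivisor modulo `a * b`, and `e = a / (a + b)` is an idempotent
  of the total ring of fractions of `O / (a * b)`, hence integral. If `x * e` lies in `O / (a * b)`,
  then `x ∈ (a, b)`; so `δ(P) ≥ dim O / (a, b)` (`rank_quotient_le_deltaInvariant`).
* Globally, `∑ P, dim O_P / (a, b) ≥ h * k`, which is one half of Bézout's theorem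
  (`exists_finset_mul_le_sum_rank`). Let `S` be the homogeneous coordinate ring of the plane.
  Counting dimensions, `S / (H, K)` has dimension at least `h * k` in degree `d` as soon as
  `d ≥ h + k` (`mul_le_rank_homogeneous_quotient`). A form of degree `d` which lies in the ideal
  `(a, b)` at every point lies in the saturation of `(H, K)`, by the Nullstellensatz, and for
  large `d` it lies in `(H, K)` itself (`exists_forall_mem_of_locally_mem`). So the degree `d` part
  of `S / (H, K)` embeds into the product of all `O_P / (a, b)`, and, being finite-dimensional,
  into the product over finitely many `P`.

Forms and local equations are compared through the ring `S[1 / X i]`, over which a form and its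
dehomogenization differ by a unit (`rehom_dehom`).
-/

namespace PlaneCurve

/-! ### The delta invariant of a union of two coprime curves -/

/-- A surjection onto `U` whose kernel contains that of `ψ : V → W` makes `U` a quotient of the
image of `ψ`, so that `dim U ≤ dim W`. -/
theorem rank_le_of_ker_le_ker {L V : Type*} {U W : Type*} [Field L] [AddCommGroup V] [Module L V]
    [AddCommGroup U] [Module L U] [AddCommGroup W] [Module L W] (π : V →ₗ[L] U)
    (hπ : Function.Surjective π) (ψ : V →ₗ[L] W) (h : LinearMap.ker ψ ≤ LinearMap.ker π) :
    Cardinal.toENat (Module.rank L U) ≤ Cardinal.toENat (Module.rank L W) := by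
  have h1 : Cardinal.lift (Module.rank L U) ≤ Cardinal.lift (Module.rank L (V ⧸ LinearMap.ker ψ)) :=
    LinearMap.lift_rank_le_of_surjective ((LinearMap.ker ψ).liftQ π h) (by
      intro u
      obtain ⟨v, rfl⟩ := hπ u
      exact ⟨Submodule.Quotient.mk v, rfl⟩)
  have h2 : Cardinal.lift (Module.rank L (V ⧸ LinearMap.ker ψ)) ≤ Cardinal.lift (Module.rank L W) :=
    LinearMap.lift_rank_le_of_injective ((LinearMap.ker ψ).liftQ ψ le_rfl)
      (LinearMap.ker_eq_bot.mp (Submodule.ker_liftQ_eq_bot' _ _ rfl))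
  have h1' := Cardinal.toENat.monotone' h1
  have h2' := Cardinal.toENat.monotone' h2
  simpa using (by simpa using h1' : Cardinal.toENat (Module.rank L U) ≤ _).trans
    (by simpa using h2')

/-- If `a` and `b` are coprime in `R`, then the delta invariant of `R / (a * b)` is at least the
dimension of `R / (a, b)`: the map `x ↦ x * a / (a + b)` to the normalization modulo `R / (a * b)`
has its kernel inside `(a, b)`. -/
theorem rank_quotient_le_deltaInvariant {L R : Type*} [Field L] [CommRing R] [Algebra L R]
    {a b : R} (h₁ : ∀ x, a ∣ b * x → a ∣ x)
    (h₂ : ∀ x, b ∣ a * x → b ∣ x) :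
    Cardinal.toENat (Module.rank L (R ⧸ Ideal.span {a, b})) ≤
      deltaInvariant L (R ⧸ Ideal.span {a * b}) := by
  set A := R ⧸ Ideal.span {a * b} with hA
  set q : R →+* A := Ideal.Quotient.mk _ with hq
  have q_zero : ∀ x, q x = 0 ↔ a * b ∣ x := fun x ↦ by
    rw [hq, Ideal.Quotient.eq_zero_iff_mem, Ideal.mem_span_singleton]
  have hnzd : q (a + b) ∈ nonZeroDivisors A := by
    rw [mem_nonZeroDivisors_iff_right]
    intro x hx
    obtain ⟨x, rfl⟩ := Ideal.Quotient.mk_surjective x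
    rw [← hq] at hx ⊢
    rw [← map_mul, q_zero] at hx
    have ha1 : a ∣ b * x := by
      have : b * x = x * (a + b) - a * x := by ring
      rw [this]
      exact dvd_sub ((dvd_mul_right a b).trans hx) (dvd_mul_right a x)
    obtain ⟨y, rfl⟩ := h₁ x ha1
    have hb1 : b ∣ a * (a * y) := by
      have : a * (a * y) = a * y * (a + b) - b * (a * y) := by ring
      rw [this]
      exact dvd_sub ((dvd_mul_left b a).trans hx) (dvd_mul_right b _)
    obtain ⟨z, rfl⟩ := h₂ _ (h₂ _ hb1)
    rw [q_zero]
    exact ⟨z, by ring⟩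
  set e : FractionRing A := IsLocalization.mk' (FractionRing A) (q a) ⟨q (a + b), hnzd⟩ with he
  have he1 : e * algebraMap A (FractionRing A) (q (a + b)) = algebraMap A _ (q a) :=
    IsLocalization.mk'_spec (FractionRing A) (q a) ⟨q (a + b), hnzd⟩
  have hu : IsUnit (algebraMap A (FractionRing A) (q (a + b))) :=
    IsLocalization.map_units (FractionRing A) (⟨q (a + b), hnzd⟩ : nonZeroDivisors A)
  have hee : e ^ 2 - e = 0 := by
    refine (hu.pow 2).mul_left_cancel ?_
    have h0 : algebraMap A (FractionRing A) (q a) * algebraMap A (FractionRing A) (q b) = 0 := by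
      rw [← map_mul, ← map_mul, (q_zero _).mpr dvd_rfl, map_zero]
    calc algebraMap A (FractionRing A) (q (a + b)) ^ 2 * (e ^ 2 - e)
        = (e * algebraMap A (FractionRing A) (q (a + b))) ^ 2
          - (e * algebraMap A (FractionRing A) (q (a + b))) *
            algebraMap A (FractionRing A) (q (a + b)) := by ring
      _ = _ := by
        rw [he1, map_add, map_add]
        linear_combination -h0
  -- The idempotent `e` is a root of the monic polynomial `X ^ 2 - X`.
  have hint : e ∈ integralClosure A (FractionRing A) :=
    ⟨Polynomial.X ^ 2 - Polynomial.X, by monicity!, by simpa using hee⟩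
  set N := Normalization A with hN
  let W := N ⧸ LinearMap.range (Algebra.linearMap A N)
  let ψ : R →ₗ[L] W :=
    (((LinearMap.range (Algebra.linearMap A N)).mkQ ∘ₗ
      LinearMap.toSpanSingleton A N ⟨e, hint⟩).restrictScalars L) ∘ₗ
        (Ideal.Quotient.mkₐ L (Ideal.span {a * b})).toLinearMap
  refine rank_le_of_ker_le_ker (Ideal.Quotient.mkₐ L (Ideal.span {a, b})).toLinearMap
    (Ideal.Quotient.mkₐ_surjective L _) ψ ?_
  intro x hx
  have hx' : (q x) • (⟨e, hint⟩ : N) ∈ LinearMap.range (Algebra.linearMap A N) :=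
    (Submodule.Quotient.mk_eq_zero _).mp hx
  obtain ⟨y, hy⟩ := hx'
  obtain ⟨y, rfl⟩ := Ideal.Quotient.mk_surjective y
  rw [← hq] at hy
  have hy' : algebraMap A (FractionRing A) (q y) = algebraMap A (FractionRing A) (q x) * e := by
    have := congrArg (Subtype.val) hy
    simpa [Algebra.smul_def] using this
  have hy2 : algebraMap A (FractionRing A) (q (y * (a + b))) =
      algebraMap A (FractionRing A) (q (x * a)) := by
    rw [map_mul, map_mul, hy', map_mul, map_mul, ← he1]; ring
  have hy3 : q (x * a - y * (a + b)) = 0 := by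
    rw [map_sub, IsFractionRing.injective A (FractionRing A) hy2, sub_self]
  rw [q_zero] at hy3
  -- From `x * a ≡ y * (a + b)` modulo `a * b` it follows that `a ∣ y`, and then `b ∣ x - y`.
  have hay : a ∣ b * y := by
    have : b * y = (x - y) * a - (x * a - y * (a + b)) := by ring
    rw [this]
    exact dvd_sub (dvd_mul_left _ _) ((dvd_mul_right a b).trans hy3)
  obtain ⟨z, rfl⟩ := h₁ _ hay
  have hbx : b ∣ a * (x - a * z) := by
    have : a * (x - a * z) = (x * a - a * z * (a + b)) + b * (a * z) := by ring
    rw [this]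
    exact dvd_add ((dvd_mul_left b a).trans hy3) (dvd_mul_right _ _)
  obtain ⟨w, hw⟩ := h₂ _ hbx
  change Ideal.Quotient.mk _ x = 0
  rw [Ideal.Quotient.eq_zero_iff_mem, Ideal.mem_span_pair]
  exact ⟨z, w, by linear_combination -hw⟩

noncomputable section

open MvPolynomial

/-! ### Affine charts of the projective plane -/

section Charts

/-- Coprimality, in the form that `a` divides `x` whenever it divides `b * x`, passes to
localizations. -/
theorem dvd_of_dvd_mul_of_isLocalization {R T : Type*} [CommRing R] [CommRing T] [Algebra R T]
    (M : Submonoid R) [IsLocalization M T] {a b : R} (h : ∀ x, a ∣ b * x → a ∣ x) (z : T)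
    (hz : algebraMap R T a ∣ algebraMap R T b * z) : algebraMap R T a ∣ z := by
  obtain ⟨y, hy⟩ := hz
  obtain ⟨⟨x, s⟩, hx⟩ := IsLocalization.surj M z
  obtain ⟨⟨y', t⟩, hy'⟩ := IsLocalization.surj M y
  simp only at hx hy'
  have h1 : algebraMap R T (b * x * t) = algebraMap R T (a * y' * s) := by
    simp only [map_mul, ← hx, ← hy']
    linear_combination (algebraMap R T s) * (algebraMap R T t) * hy
  obtain ⟨c, hc⟩ := (IsLocalization.eq_iff_exists M T).mp h1
  have h2 : a ∣ x * t * c := h _ ⟨y' * s * c, by linear_combination hc⟩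
  have h3 := map_dvd (algebraMap R T) h2
  rw [map_mul, map_mul, ← hx, mul_assoc, mul_assoc] at h3
  exact ((((IsLocalization.map_units T s).mul ((IsLocalization.map_units T t).mul
    (IsLocalization.map_units T c)))).dvd_mul_right).mp h3

theorem aeval_mul_X_of_isHomogeneous {σ L T : Type*} [CommSemiring L] [CommSemiring T] [Algebra L T]
    {G : MvPolynomial σ L} {d : ℕ} (hG : G.IsHomogeneous d) (c : T) (y : σ → T) :
    aeval (fun j ↦ c * y j) G = c ^ d * aeval y G := by
  rw [aeval_def, aeval_def, eval₂_eq, eval₂_eq, Finset.mul_sum]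
  refine Finset.sum_congr rfl fun m hm ↦ ?_
  have : d = ∑ i ∈ m.support, m i := hG.degree_eq_sum_deg_support hm
  rw [this, ← Finset.prod_pow_eq_pow_sum]
  simp_rw [mul_pow]
  rw [Finset.prod_mul_distrib]
  ring

variable {L : Type*} [Field L] (v : Fin 3 → L) (i : Fin 3)

/-- Restriction of forms to the affine chart around `v` on which the `i`-th coordinate is constant,
translated so that `v` becomes the origin. The local equation of `F` at `P` is the value at `F` for
`v = P.rep` and `i = chartIndex P`. -/
def dehom : MvPolynomial (Fin 3) L →ₐ[L] MvPolynomial (Fin 2) L :=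
  aeval (fun j : Fin 3 => C (v j) + (if j = i + 1 then X 0 else 0) + (if j = i + 2 then X 1 else 0))

theorem constantCoeff_dehom (G : MvPolynomial (Fin 3) L) :
    constantCoeff (dehom v i G) = eval v G := by
  have : (constantCoeff : MvPolynomial (Fin 2) L →+* L).comp (dehom v i).toRingHom = eval v := by
    refine MvPolynomial.ringHom_ext (fun r ↦ ?_) fun j ↦ ?_
    · simp
    · simp only [dehom, AlgHom.toRingHom_eq_coe, RingHom.coe_comp, RingHom.coe_coe,
        Function.comp_apply, aeval_X, map_add, constantCoeff_C, eval_X]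
      split_ifs <;> simp
  exact congrArg (fun f ↦ f G) this

theorem dehom_X_self : dehom v i (X i) = C (v i) := by
  fin_cases i <;> simp [dehom]

/-- The ring `L[X 0, X 1, X 2][1 / X i]`. -/
abbrev ChartRing (L : Type*) [Field L] (i : Fin 3) : Type _ :=
  Localization.Away (X i : MvPolynomial (Fin 3) L)

/-- The factor `v i / X i`, which rescales homogeneous coordinates so that the `i`-th one becomes
`v i`. -/
def chartFactor : ChartRing L i :=
  algebraMap L (ChartRing L i) (v i) * IsLocalization.Away.invSelf (X i : MvPolynomial (Fin 3) L)

/-- The affine coordinates of the chart `dehom v i`, as functions of degree zero of the homogeneous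
coordinates: a section of the extension of `dehom v i` to `ChartRing L i`. -/
def rehom : MvPolynomial (Fin 2) L →ₐ[L] ChartRing L i :=
  aeval (fun j : Fin 2 ↦ chartFactor v i *
    algebraMap (MvPolynomial (Fin 3) L) (ChartRing L i) (X (if j = 0 then i + 1 else i + 2)) -
      algebraMap L (ChartRing L i) (v (if j = 0 then i + 1 else i + 2)))

/-- For a form `G` of degree `d`, dehomogenizing and homogenizing again gives
`(v i / X i) ^ d * G`. -/
theorem rehom_dehom {G : MvPolynomial (Fin 3) L} {d : ℕ} (hG : G.IsHomogeneous d) :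
    rehom v i (dehom v i G) =
      chartFactor v i ^ d *
        algebraMap (MvPolynomial (Fin 3) L) (ChartRing L i) G := by
  have h1 : algebraMap (MvPolynomial (Fin 3) L) (ChartRing L i) G =
      aeval (fun j ↦ algebraMap (MvPolynomial (Fin 3) L) (ChartRing L i) (X j)) G := by
    have : IsScalarTower.toAlgHom L (MvPolynomial (Fin 3) L) (ChartRing L i) =
      aeval (fun j ↦ algebraMap (MvPolynomial (Fin 3) L) (ChartRing L i) (X j)) := by
      ext j; simp
    exact congrArg (fun f ↦ f G) this
  rw [h1, ← aeval_mul_X_of_isHomogeneous hG]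
  have hinv : algebraMap (MvPolynomial (Fin 3) L) (ChartRing L i) (X i) *
      IsLocalization.Away.invSelf (X i : MvPolynomial (Fin 3) L) = 1 :=
    IsLocalization.Away.mul_invSelf _
  have : (rehom v i).comp (dehom v i) = aeval (fun j ↦
      chartFactor v i *
        algebraMap (MvPolynomial (Fin 3) L) (ChartRing L i) (X j)) := by
    refine MvPolynomial.algHom_ext fun j ↦ ?_
    have hC : ∀ r : L, rehom v i (C r) = algebraMap L _ r := fun r ↦ (rehom v i).commutes r
    have hj := (by decide : ∀ i j : Fin 3, j = i ∨ j = i + 1 ∨ j = i + 2) i j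
    have h12 := (by decide : ∀ i : Fin 3, i + 2 ≠ i + 1 ∧ i ≠ i + 1 ∧ i ≠ i + 2) i
    rw [AlgHom.comp_apply, dehom, aeval_X, aeval_X, map_add, map_add, hC]
    rcases hj with rfl | rfl | rfl
    · simp only [h12.2.1, h12.2.2, if_false, map_zero, add_zero]
      rw [chartFactor]
      linear_combination -(algebraMap L (ChartRing L j) (v j)) * hinv
    · simp [h12.1.symm, rehom]
    · simp [h12.1, rehom]
  exact congrArg (fun f ↦ f G) this

theorem isUnit_chartFactor {v : Fin 3 → L} {i : Fin 3} (hi : v i ≠ 0) :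
    IsUnit (chartFactor v i) :=
  ((isUnit_iff_ne_zero.mpr hi).map (algebraMap L (ChartRing L i))).mul
    (IsUnit.of_mul_eq_one _ ((mul_comm _ _).trans (IsLocalization.Away.mul_invSelf (X i))))

theorem isUnit_dehom_X {v : Fin 3 → L} {i : Fin 3} (hi : v i ≠ 0) :
    IsUnit ((dehom v i).toRingHom (X i)) := by
  have : (dehom v i).toRingHom (X i) = C (v i) := dehom_X_self v i
  rw [this]
  exact (isUnit_iff_ne_zero.mpr hi).map C

/-- The extension of `dehom v i` to `ChartRing L i` is a left inverse of `rehom v i`. -/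
theorem lift_dehom_rehom {v : Fin 3 → L} {i : Fin 3} (hi : v i ≠ 0)
    (p : MvPolynomial (Fin 2) L) :
    IsLocalization.Away.lift (X i) (isUnit_dehom_X hi) (rehom v i p) = p := by
  set φ : ChartRing L i →+* MvPolynomial (Fin 2) L :=
    IsLocalization.Away.lift (X i) (isUnit_dehom_X hi) with hφ
  have hφa : ∀ G, φ (algebraMap _ _ G) = dehom v i G := fun G ↦
    IsLocalization.Away.lift_eq (X i) (isUnit_dehom_X hi) G
  have hφC : ∀ r : L, φ (algebraMap L _ r) = C r := fun r ↦ by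
    rw [IsScalarTower.algebraMap_apply L (MvPolynomial (Fin 3) L) (ChartRing L i), hφa]
    exact (dehom v i).commutes r
  have hinv : C (v i) * φ (IsLocalization.Away.invSelf (X i : MvPolynomial (Fin 3) L)) = 1 := by
    rw [← dehom_X_self, ← hφa, ← map_mul, IsLocalization.Away.mul_invSelf, map_one]
  have : φ.comp (rehom v i).toRingHom = RingHom.id _ := by
    refine MvPolynomial.ringHom_ext (fun r ↦ ?_) fun j ↦ ?_
    · exact (congrArg φ ((rehom v i).commutes r)).trans (hφC r)
    · have h12 := (by decide : ∀ i : Fin 3, i + 2 ≠ i + 1 ∧ i + 1 ≠ i + 2) i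
      simp only [AlgHom.toRingHom_eq_coe, RingHom.coe_comp, RingHom.coe_coe, Function.comp_apply,
        rehom, chartFactor, aeval_X, map_sub, map_mul, hφC, hφa, RingHom.id_apply, hinv, one_mul]
      fin_cases j <;> simp [dehom, h12.1, h12.2]
  exact congrArg (fun f ↦ f p) this

/-- Coprime forms have coprime dehomogenizations: the divisibility is transported to
`ChartRing L i`, where a form and its dehomogenization are associated, and back. -/
theorem dehom_dvd_of_dvd_mul {v : Fin 3 → L} {i : Fin 3} (hi : v i ≠ 0)
    {H K : MvPolynomial (Fin 3) L} {h k : ℕ} (hH : H.IsHomogeneous h) (hK : K.IsHomogeneous k)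
    (hrel : IsRelPrime H K) (p : MvPolynomial (Fin 2) L)
    (hp : dehom v i H ∣ dehom v i K * p) : dehom v i H ∣ p := by
  have h1 := map_dvd (rehom v i) hp
  rw [map_mul, rehom_dehom v i hH, rehom_dehom v i hK, mul_assoc] at h1
  have hu := isUnit_chartFactor hi
  rw [(hu.pow h).mul_left_dvd, (hu.pow k).dvd_mul_left] at h1
  have h2 := dvd_of_dvd_mul_of_isLocalization (Submonoid.powers (X i : MvPolynomial (Fin 3) L))
    (fun _ ↦ hrel.dvd_of_dvd_mul_left) _ h1
  rw [← (hu.pow h).mul_left_dvd, ← rehom_dehom v i hH] at h2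
  have h3 := map_dvd (IsLocalization.Away.lift (X i) (isUnit_dehom_X hi)) h2
  rwa [lift_dehom_rehom hi, lift_dehom_rehom hi] at h3

/-- If `G` lies in the ideal of `H` and `K` in the local ring at `v`, then some polynomial which
does not vanish at `v` multiplies `G` into the ideal `(H, K)`. -/
theorem exists_mul_mem_of_dehom_mem {v : Fin 3 → L} {i : Fin 3} (hi : v i ≠ 0)
    {H K G : MvPolynomial (Fin 3) L} {h k d : ℕ} (hH : H.IsHomogeneous h) (hK : K.IsHomogeneous k)
    (hG : G.IsHomogeneous d)
    (hmem : algebraMap _ (PlaneLocalRing L) (dehom v i G) ∈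
      Ideal.span {algebraMap _ (PlaneLocalRing L) (dehom v i H),
        algebraMap _ (PlaneLocalRing L) (dehom v i K)}) :
    ∃ s, eval v s ≠ 0 ∧ s * G ∈ Ideal.span {H, K} := by
  have hmap : ∀ {R S : Type _} [CommRing R] [CommRing S] (f : R →+* S) (a b : R),
      (Ideal.span {a, b}).map f = Ideal.span {f a, f b} := fun f a b ↦ by
    rw [Ideal.map_span, Set.image_pair]
  rw [← hmap, IsLocalization.algebraMap_mem_map_algebraMap_iff (originIdeal L).primeCompl] at hmem
  obtain ⟨u, hu, hmem⟩ := hmem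
  have hc := isUnit_chartFactor hi
  have h1 := Ideal.mem_map_of_mem (rehom v i).toRingHom hmem
  rw [hmap] at h1
  have h2 : rehom v i u * algebraMap _ _ G ∈
      (Ideal.span {H, K}).map (algebraMap _ (ChartRing L i)) := by
    rw [hmap]
    have e1 : ∀ {G d} (_ : IsHomogeneous G d), (rehom v i).toRingHom (dehom v i G) =
        chartFactor v i ^ d * algebraMap _ _ G := fun h ↦ rehom_dehom v i h
    rw [map_mul, e1 hG, e1 hH, e1 hK] at h1
    rw [Ideal.mem_span_pair] at h1 ⊢
    obtain ⟨p, q, hpq⟩ := h1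
    obtain ⟨c', hc'⟩ := (hc.pow d).exists_left_inv
    refine ⟨c' * p * chartFactor v i ^ h, c' * q * chartFactor v i ^ k, ?_⟩
    change _ = (rehom v i).toRingHom u * _
    linear_combination c' * hpq + ((rehom v i).toRingHom u * algebraMap _ _ G) * hc'
  -- The numerator `s₀` of `rehom v i u`, times a power of `X i`, is the required factor.
  obtain ⟨n, s₀, hs₀⟩ := IsLocalization.Away.surj (X i : MvPolynomial (Fin 3) L) (rehom v i u)
  have h3 : algebraMap _ (ChartRing L i) (s₀ * G) ∈
      (Ideal.span {H, K}).map (algebraMap _ (ChartRing L i)) := by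
    rw [map_mul, ← hs₀, mul_right_comm]
    exact Ideal.mul_mem_right _ _ h2
  rw [IsLocalization.algebraMap_mem_map_algebraMap_iff
    (Submonoid.powers (X i : MvPolynomial (Fin 3) L))] at h3
  obtain ⟨_, ⟨m, rfl⟩, h3⟩ := h3
  refine ⟨X i ^ m * s₀, ?_, by simpa [mul_assoc] using h3⟩
  have h4 := congrArg (IsLocalization.Away.lift (X i) (isUnit_dehom_X hi)) hs₀
  rw [map_mul, map_pow, IsLocalization.Away.lift_eq, IsLocalization.Away.lift_eq,
    lift_dehom_rehom hi] at h4
  have h5 := congrArg constantCoeff h4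
  have h6 : constantCoeff u ≠ 0 := hu
  simp only [map_mul, map_pow, AlgHom.toRingHom_eq_coe, RingHom.coe_coe, constantCoeff_dehom,
    eval_X] at h5
  rw [map_mul, map_pow, eval_X, ← h5]
  exact mul_ne_zero (pow_ne_zero _ hi) (mul_ne_zero h6 (pow_ne_zero _ hi))

end Charts

/-! ### Homogeneous components of products -/

section Grading

variable {σ L : Type*} [Field L]

/-- The coaction `G ↦ G (t * X)` which encodes the grading: the coefficient of `t ^ n` is the
homogeneous component of degree `n`. -/
def gradingHom (σ L : Type*) [Field L] :
    MvPolynomial σ L →ₐ[L] Polynomial (MvPolynomial σ L) :=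
  aeval (fun j ↦ Polynomial.X * Polynomial.C (X j))

theorem gradingHom_of_isHomogeneous {G : MvPolynomial σ L} {d : ℕ} (hG : G.IsHomogeneous d) :
    gradingHom σ L G = Polynomial.C G * Polynomial.X ^ d := by
  rw [gradingHom, aeval_mul_X_of_isHomogeneous hG, mul_comm]
  congr 1
  have : aeval (fun j ↦ Polynomial.C (X j)) =
      IsScalarTower.toAlgHom L (MvPolynomial σ L) (Polynomial (MvPolynomial σ L)) := by
    ext1 j; simp
  rw [this]
  rfl

theorem coeff_gradingHom (G : MvPolynomial σ L) (n : ℕ) :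
    (gradingHom σ L G).coeff n = homogeneousComponent n G := by
  conv_lhs => rw [← sum_homogeneousComponent G, map_sum, Polynomial.finsetSum_coeff]
  simp_rw [gradingHom_of_isHomogeneous (homogeneousComponent_isHomogeneous _ G),
    Polynomial.coeff_C_mul_X_pow]
  rw [Finset.sum_ite_eq]
  split_ifs with h
  · rfl
  · exact (homogeneousComponent_eq_zero _ _ (by simpa using h)).symm

theorem homogeneousComponent_add_mul {H : MvPolynomial σ L} {h : ℕ} (hH : H.IsHomogeneous h)
    (p : MvPolynomial σ L) (e : ℕ) :
    homogeneousComponent (e + h) (p * H) = homogeneousComponent e p * H := by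
  rw [← coeff_gradingHom, map_mul, gradingHom_of_isHomogeneous hH, ← mul_assoc,
    Polynomial.coeff_mul_X_pow, Polynomial.coeff_mul_C, coeff_gradingHom]

/-- A divisor of a nonzero form is a form. Both the highest and the lowest degree are additive
under multiplication, and they agree for the product, so they agree for each factor. -/
theorem isHomogeneous_of_mul_isHomogeneous {H K : MvPolynomial σ L} {f : ℕ}
    (hHK : (H * K).IsHomogeneous f) (h0 : H * K ≠ 0) : H.IsHomogeneous H.totalDegree := by
  have hH0 : H ≠ 0 := left_ne_zero_of_mul h0
  have hK0 : K ≠ 0 := right_ne_zero_of_mul h0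
  have hinj : ∀ G : MvPolynomial σ L, G ≠ 0 → gradingHom σ L G ≠ 0 := fun G hG h ↦ hG <| by
    rw [← sum_homogeneousComponent G]
    refine Finset.sum_eq_zero fun n _ ↦ ?_
    rw [← coeff_gradingHom, h, Polynomial.coeff_zero]
  have hmul := gradingHom_of_isHomogeneous hHK
  rw [map_mul] at hmul
  have h1 := congrArg Polynomial.natDegree hmul
  have h2 := congrArg Polynomial.natTrailingDegree hmul
  rw [Polynomial.natDegree_mul (hinj _ hH0) (hinj _ hK0), Polynomial.natDegree_C_mul_X_pow _ _ h0]
    at h1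
  rw [Polynomial.natTrailingDegree_mul (hinj _ hH0) (hinj _ hK0),
    Polynomial.C_mul_X_pow_eq_monomial, Polynomial.natTrailingDegree_monomial h0] at h2
  have h3 := Polynomial.natTrailingDegree_le_natDegree (gradingHom σ L H)
  have h4 := Polynomial.natTrailingDegree_le_natDegree (gradingHom σ L K)
  set d := (gradingHom σ L H).natDegree with hd
  have hHd : H = homogeneousComponent d H := by
    conv_lhs => rw [← sum_homogeneousComponent H]
    have hz : ∀ n, n ≠ d → homogeneousComponent n H = 0 := fun n hn ↦ by
      rw [← coeff_gradingHom]
      rcases lt_or_gt_of_ne hn with hn | hn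
      · exact Polynomial.coeff_eq_zero_of_lt_natTrailingDegree (by omega)
      · exact Polynomial.coeff_eq_zero_of_natDegree_lt hn
    rw [Finset.sum_eq_single d (fun n _ hn ↦ hz n hn)]
    intro hn
    exact homogeneousComponent_eq_zero _ _ (by simpa using hn)
  have hHh : H.IsHomogeneous d := hHd ▸ homogeneousComponent_isHomogeneous d H
  rwa [hHh.totalDegree hH0]

theorem finrank_homogeneousSubmodule_fin_three (L : Type*) [Field L] (d : ℕ) :
    Module.finrank L (homogeneousSubmodule (Fin 3) L d) = (d + 2).choose 2 := by
  have hset : {m : Fin 3 →₀ ℕ | m.degree = d} =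
      ((Finset.univ.finsuppAntidiag d : Finset (Fin 3 →₀ ℕ)) : Set (Fin 3 →₀ ℕ)) := by
    ext m
    simp [Finset.mem_finsuppAntidiag, Finsupp.degree_eq_sum]
  rw [homogeneousSubmodule_eq_finsupp_supported]
  refine (Module.finrank_eq_nat_card_basis (basisRestrictSupport L _)).trans ?_
  rw [hset, Nat.card_coe_set_eq, Set.ncard_coe_finset, Finset.card_finsuppAntidiag_nat_eq_choose,
    Finset.card_univ, Fintype.card_fin, show 3 + d - 1 = d + 2 by omega]
  exact Nat.choose_symm_add

end Grading

/-! ### The graded quotient by two forms -/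

section Bezout

variable {L : Type*} [Field L]

instance (d : ℕ) : FiniteDimensional L (homogeneousSubmodule (Fin 3) L d) :=
  Module.Finite.iff_fg.mpr (homogeneousSubmodule_fg _ _ d)

/-- The dimension count behind the value `h * k` of the Hilbert polynomial of the quotient by two
coprime forms of degrees `h` and `k`. -/
theorem choose_two_add_mul (h k e : ℕ) :
    (h + k + e + 2).choose 2 + (e + 2).choose 2 =
      (k + e + 2).choose 2 + (h + e + 2).choose 2 + h * k := by
  have key : ∀ n : ℕ, ((n + 2).choose 2 : ℚ) = (n + 2) * (n + 1) / 2 := fun n ↦ by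
    rw [Nat.cast_choose_two]; push_cast; ring
  have : (((h + k + e + 2).choose 2 + (e + 2).choose 2 : ℕ) : ℚ) =
      ((k + e + 2).choose 2 + (h + e + 2).choose 2 + h * k : ℕ) := by
    push_cast
    rw [key e]
    have h1 := key (h + k + e)
    have h2 := key (k + e)
    have h3 := key (h + e)
    push_cast at h1 h2 h3
    rw [h1, h2, h3]
    ring
  exact_mod_cast this

/-- In degree `h + k + e` the ideal `(H, K)` is the sum of the multiples of `H` and those of `K`,
whose intersection contains the multiples of `H * K`; so its codimension is at least `h * k`. -/
theorem mul_le_rank_homogeneous_quotient {H K : MvPolynomial (Fin 3) L} {h k : ℕ}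
    (hH : H.IsHomogeneous h) (hK : K.IsHomogeneous k) (hH0 : H ≠ 0) (hK0 : K ≠ 0) (e : ℕ) :
    ((h * k : ℕ) : ℕ∞) ≤ Cardinal.toENat (Module.rank L
      (homogeneousSubmodule (Fin 3) L (h + k + e) ⧸
        ((Ideal.span {H, K}).restrictScalars L).comap
          (homogeneousSubmodule (Fin 3) L (h + k + e)).subtype)) := by
  set S := homogeneousSubmodule (Fin 3) L
  set J := ((Ideal.span {H, K}).restrictScalars L).comap (S (h + k + e)).subtype with hJ
  rw [← Module.finrank_eq_rank]
  simp only [Cardinal.toENat_nat, Nat.cast_le]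
  have hquot := Submodule.finrank_quotient_add_finrank J
  set U := (S (k + e)).map (LinearMap.mulRight L H)
  set V := (S (h + e)).map (LinearMap.mulRight L K)
  have hUV := Submodule.finrank_sup_add_finrank_inf_eq U V
  have hmap : ∀ {G : MvPolynomial (Fin 3) L}, G ≠ 0 → ∀ d,
      Module.finrank L ((S d).map (LinearMap.mulRight L G)) = (d + 2).choose 2 := fun hG d ↦ by
    rw [← finrank_homogeneousSubmodule_fin_three L d]
    exact (LinearEquiv.finrank_eq (Submodule.equivMapOfInjective _ (mul_left_injective₀ hG) _)).symm
  have hinf : (e + 2).choose 2 ≤ Module.finrank L ↥(U ⊓ V) := by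
    rw [← hmap (mul_ne_zero hH0 hK0) e]
    refine Submodule.finrank_mono ?_
    rintro _ ⟨p, hp, rfl⟩
    refine ⟨⟨p * K, ?_, ?_⟩, ⟨p * H, ?_, ?_⟩⟩
    · rw [add_comm]; exact hp.mul hK
    · simp only [LinearMap.mulRight_apply]; ring
    · rw [add_comm]; exact hp.mul hH
    · simp only [LinearMap.mulRight_apply]; ring
  have hJle : Module.finrank L J ≤ Module.finrank L ↥(U ⊔ V) := by
    rw [← (LinearEquiv.finrank_eq (Submodule.equivMapOfInjective (S (h + k + e)).subtype
      (Submodule.injective_subtype _) J)).symm]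
    refine Submodule.finrank_mono ?_
    rintro _ ⟨⟨G, hG⟩, hGJ, rfl⟩
    obtain ⟨p, q, hpq⟩ := Ideal.mem_span_pair.mp (show G ∈ Ideal.span {H, K} from hGJ)
    have hG' : G = homogeneousComponent (k + e) p * H + homogeneousComponent (h + e) q * K := by
      rw [← homogeneousComponent_add_mul hH, ← homogeneousComponent_add_mul hK,
        show k + e + h = h + k + e by ring, show h + e + k = h + k + e by ring, ← map_add, hpq]
      exact (homogeneousComponent_of_mem hG).symm ▸ (if_pos rfl).symm
    simp only [Submodule.subtype_apply]
    rw [hG']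
    exact Submodule.add_mem_sup ⟨_, homogeneousComponent_mem _ p, rfl⟩
      ⟨_, homogeneousComponent_mem _ q, rfl⟩
  rw [hmap hH0, hmap hK0] at hUV
  rw [finrank_homogeneousSubmodule_fin_three] at hquot
  have := choose_two_add_mul h k e
  omega

/-- An ideal with no zero other than possibly the origin contains a power of every variable. -/
theorem X_mem_radical_of_forall_exists_eval_ne_zero [IsAlgClosed L] {σ : Type*} [Finite σ]
    (I : Ideal (MvPolynomial σ L)) (hI : ∀ v : σ → L, v ≠ 0 → ∃ s ∈ I, eval v s ≠ 0) (j : σ) :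
    X j ∈ I.radical := by
  rw [← vanishingIdeal_zeroLocus_eq_radical (K := L)]
  intro v hv
  by_cases hv0 : v = 0
  · simp [hv0]
  · obtain ⟨s, hs, hne⟩ := hI v hv0
    exact absurd (hv s hs) hne

/-- A monomial in three variables of degree at least `3 * N` is divisible by the `N`-th power of
one of them. -/
theorem mul_mem_of_X_pow_mul_mem {J : Ideal (MvPolynomial (Fin 3) L)} {c g : MvPolynomial (Fin 3) L}
    {N e : ℕ} (hc : c.IsHomogeneous e) (he : 3 * N ≤ e) (hg : ∀ j, X j ^ N * g ∈ J) :
    c * g ∈ J := by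
  rw [c.as_sum, Finset.sum_mul]
  refine Ideal.sum_mem _ fun m hm ↦ ?_
  have hdeg : e = ∑ j, m j := by
    rw [hc.degree_eq_sum_deg_support hm]
    exact Finset.sum_subset (Finset.subset_univ _) (by simp)
  obtain ⟨j, hj⟩ : ∃ j, N ≤ m j := by
    by_contra! hlt
    have h0 := hlt 0
    have h1 := hlt 1
    have h2 := hlt 2
    rw [Fin.sum_univ_three] at hdeg
    omega
  have hdvd : X j ^ N ∣ monomial m (coeff m c) := by
    rw [X_pow_eq_monomial, monomial_dvd_monomial]
    exact ⟨Or.inr (by simpa using hj), one_dvd _⟩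
  obtain ⟨r, hr⟩ := hdvd
  rw [hr, mul_comm _ r, mul_assoc]
  exact Ideal.mul_mem_left _ _ (hg j)

theorem exists_X_pow_mul_mem [IsAlgClosed L] {J : Ideal (MvPolynomial (Fin 3) L)}
    {g : MvPolynomial (Fin 3) L}
    (hg : ∀ v : Fin 3 → L, v ≠ 0 → ∃ s, eval v s ≠ 0 ∧ s * g ∈ J) :
    ∃ N, ∀ n ≥ N, ∀ j, X j ^ n * g ∈ J := by
  have h (j : Fin 3) : ∃ N, X j ^ N * g ∈ J :=
    X_mem_radical_of_forall_exists_eval_ne_zero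
      (Submodule.comap (LinearMap.mulRight (MvPolynomial (Fin 3) L) g) J)
      (fun v hv ↦ (hg v hv).imp fun s hs ↦ ⟨hs.2, hs.1⟩) j
  choose N hN using h
  refine ⟨∑ j, N j, fun n hn j ↦ ?_⟩
  have hle : N j ≤ n :=
    (Finset.single_le_sum (fun _ _ ↦ Nat.zero_le _) (Finset.mem_univ j)).trans hn
  rw [← Nat.sub_add_cancel hle, pow_add, mul_assoc]
  exact Ideal.mul_mem_left _ _ (hN j)

/-- Forms of large degree in the saturation of `J` lie in `J`. These forms, in all degrees,
generate an ideal which is generated by finitely many of them, each multiplied into `J` by the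
`N`-th powers of the variables, and a form of large degree is a combination of them with
coefficients of degree at least `3 * N`. -/
theorem exists_forall_mem_of_locally_mem [IsAlgClosed L] (J : Ideal (MvPolynomial (Fin 3) L)) :
    ∃ n₀, ∀ d ≥ n₀, ∀ G : MvPolynomial (Fin 3) L, G.IsHomogeneous d →
      (∀ v : Fin 3 → L, v ≠ 0 → ∃ s, eval v s ≠ 0 ∧ s * G ∈ J) → G ∈ J := by
  let T : Set (MvPolynomial (Fin 3) L) := {G | (∃ d, G.IsHomogeneous d) ∧
    ∀ v : Fin 3 → L, v ≠ 0 → ∃ s, eval v s ≠ 0 ∧ s * G ∈ J}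
  obtain ⟨t, htT, ht⟩ := (Submodule.fg_span_iff_fg_span_finset_subset T).mp
    (IsNoetherian.noetherian (Ideal.span T))
  have hN : ∀ g ∈ t, ∃ N, ∀ n ≥ N, ∀ j, X j ^ n * g ∈ J := fun g hg ↦
    exists_X_pow_mul_mem (htT hg).2
  have hd : ∀ g ∈ t, ∃ d, g.IsHomogeneous d := fun g hg ↦ (htT hg).1
  choose! N hN using hN
  choose! δ hδ using hd
  refine ⟨t.sup δ + 3 * t.sup N, fun d hdn G hG hloc ↦ ?_⟩
  have hGt : G ∈ Submodule.span (MvPolynomial (Fin 3) L) (t : Set (MvPolynomial (Fin 3) L)) :=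
    ht ▸ Submodule.subset_span ⟨⟨d, hG⟩, hloc⟩
  obtain ⟨c, -, hc⟩ := Submodule.mem_span_finset.mp hGt
  have hGc : homogeneousComponent d G = G := (homogeneousComponent_of_mem hG).trans (if_pos rfl)
  rw [← hGc, ← hc, map_sum]
  refine Ideal.sum_mem _ fun g hg ↦ ?_
  have h1 : δ g ≤ t.sup δ := Finset.le_sup hg
  rw [smul_eq_mul, ← Nat.sub_add_cancel (show δ g ≤ d by omega),
    homogeneousComponent_add_mul (hδ g hg)]
  exact mul_mem_of_X_pow_mul_mem (homogeneousComponent_isHomogeneous _ _)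
    (show 3 * t.sup N ≤ d - δ g by omega) (hN g hg _ (Finset.le_sup hg))

theorem toENat_rank_quotient_iInf_ker_le {V ι : Type*} [AddCommGroup V] [Module L V]
    {Q : ι → Type*} [∀ i, AddCommGroup (Q i)] [∀ i, Module L (Q i)] (Φ : ∀ i, V →ₗ[L] Q i)
    (s : Finset ι) :
    Cardinal.toENat (Module.rank L (V ⧸ ⨅ i ∈ s, LinearMap.ker (Φ i))) ≤
      ∑ i ∈ s, Cardinal.toENat (Module.rank L (Q i)) := by
  classical
  induction s using Finset.induction_on with
  | empty =>
    have : Subsingleton (V ⧸ ⨅ i ∈ (∅ : Finset ι), LinearMap.ker (Φ i)) :=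
      Submodule.Quotient.subsingleton_iff.mpr (by simp)
    simp
  | insert i s hi ih =>
    rw [Finset.sum_insert hi]
    refine (rank_le_of_ker_le_ker (Submodule.mkQ _) (Submodule.mkQ_surjective _)
      ((Φ i).prod (⨅ i ∈ s, LinearMap.ker (Φ i)).mkQ) ?_).trans ?_
    · rw [LinearMap.ker_prod, Submodule.ker_mkQ, Submodule.ker_mkQ, Finset.iInf_insert]
    · rw [rank_prod, map_add, Cardinal.toENat_lift, Cardinal.toENat_lift]
      gcongr

theorem exists_finset_iInf_eq_iInf {V ι : Type*} [AddCommGroup V] [Module L V]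
    [FiniteDimensional L V] (W : ι → Submodule L V) : ∃ s : Finset ι, ⨅ i ∈ s, W i = ⨅ i, W i := by
  classical
  obtain ⟨_, ⟨s, rfl⟩, hs⟩ := IsArtinian.set_has_minimal
    (Set.range fun s : Finset ι ↦ ⨅ i ∈ s, W i) (Set.range_nonempty _)
  refine ⟨s, le_antisymm (le_iInf fun i ↦ ?_) (le_iInf₂ fun i _ ↦ iInf_le W i)⟩
  have h := hs _ ⟨insert i s, rfl⟩
  simp only [Finset.iInf_insert] at h
  exact inf_eq_right.mp (inf_le_right.eq_of_not_lt h)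

/-- If the maps `Φ i` on a finite-dimensional space separate its points modulo `N`, then finitely
many of them do, and their targets have total dimension at least that of `V / N`. -/
theorem exists_finset_toENat_rank_quotient_le {V ι : Type*} [AddCommGroup V] [Module L V]
    [FiniteDimensional L V] {Q : ι → Type*} [∀ i, AddCommGroup (Q i)] [∀ i, Module L (Q i)]
    (Φ : ∀ i, V →ₗ[L] Q i) (N : Submodule L V) (hN : ∀ x, (∀ i, Φ i x = 0) → x ∈ N) :
    ∃ s : Finset ι, Cardinal.toENat (Module.rank L (V ⧸ N)) ≤
      ∑ i ∈ s, Cardinal.toENat (Module.rank L (Q i)) := by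
  obtain ⟨s, hs⟩ := exists_finset_iInf_eq_iInf fun i ↦ LinearMap.ker (Φ i)
  refine ⟨s, (rank_le_of_ker_le_ker N.mkQ N.mkQ_surjective (⨅ i ∈ s, LinearMap.ker (Φ i)).mkQ
    ?_).trans (toENat_rank_quotient_iInf_ker_le Φ s)⟩
  rw [Submodule.ker_mkQ, Submodule.ker_mkQ, hs]
  exact fun x hx ↦ hN x fun i ↦ (Submodule.mem_iInf _).mp hx i

end Bezout

/-! ### Intersection numbers and the genus -/

section Intersection

variable {L : Type*} [Field L]

theorem chartIndex_spec (P : ℙ L (Fin 3 → L)) : P.rep (chartIndex P) ≠ 0 :=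
  (Function.ne_iff.mp P.rep_nonzero).choose_spec

/-- The image of the local equation of `V(F)` at `P` in the local ring of the plane at `P`. -/
abbrev germ (F : MvPolynomial (Fin 3) L) (P : ℙ L (Fin 3 → L)) : PlaneLocalRing L :=
  algebraMap _ (PlaneLocalRing L) (dehom P.rep (chartIndex P) F)

/-- The intersection number of `H` and `K` at `P` is at most the delta invariant of `H * K`. -/
theorem toENat_rank_le_delta_mul {H K : MvPolynomial (Fin 3) L} {h k : ℕ} (hH : H.IsHomogeneous h)
    (hK : K.IsHomogeneous k) (hrel : IsRelPrime H K) (P : ℙ L (Fin 3 → L)) :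
    Cardinal.toENat (Module.rank L (PlaneLocalRing L ⧸ Ideal.span {germ H P, germ K P})) ≤
      delta (H * K) P := by
  have hdelta : delta (H * K) P =
      deltaInvariant L (PlaneLocalRing L ⧸ Ideal.span {germ H P * germ K P}) := by
    change deltaInvariant L (PlaneLocalRing L ⧸ Ideal.span
      {algebraMap _ (PlaneLocalRing L) (dehom P.rep (chartIndex P) (H * K))}) = _
    rw [map_mul, map_mul]
  rw [hdelta]
  exact rank_quotient_le_deltaInvariant
    (dvd_of_dvd_mul_of_isLocalization (originIdeal L).primeCompl
      (dehom_dvd_of_dvd_mul (chartIndex_spec P) hH hK hrel))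
    (dvd_of_dvd_mul_of_isLocalization (originIdeal L).primeCompl
      (dehom_dvd_of_dvd_mul (chartIndex_spec P) hK hH hrel.symm))

/-- A form `G` which lies in the ideal of `H` and `K` at every point of the plane lies in the
saturation of `(H, K)`. -/
theorem exists_mul_mem_of_germ_mem {H K G : MvPolynomial (Fin 3) L} {h k d : ℕ}
    (hH : H.IsHomogeneous h) (hK : K.IsHomogeneous k) (hG : G.IsHomogeneous d)
    (hmem : ∀ P, germ G P ∈ Ideal.span {germ H P, germ K P}) (v : Fin 3 → L) (hv : v ≠ 0) :
    ∃ s, eval v s ≠ 0 ∧ s * G ∈ Ideal.span {H, K} := by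
  set P := Projectivization.mk L v hv with hP
  obtain ⟨s, hs, hsG⟩ := exists_mul_mem_of_dehom_mem (chartIndex_spec P) hH hK hG (hmem P)
  obtain ⟨a, ha⟩ := Projectivization.exists_smul_eq_mk_rep L v hv
  -- Substituting `a • X` for `X` moves the point from the chosen representative of `P` to `v`.
  let α : MvPolynomial (Fin 3) L →ₐ[L] MvPolynomial (Fin 3) L := aeval fun j ↦ C (a : L) * X j
  have hα : ∀ {A : MvPolynomial (Fin 3) L} {n : ℕ}, A.IsHomogeneous n → α A = C (a : L) ^ n * A :=
    fun hA ↦ by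
      have := aeval_mul_X_of_isHomogeneous hA (C (a : L)) X
      rwa [aeval_X_left_apply] at this
  have hαe : eval v (α s) = eval P.rep s := by
    have : (eval v).comp α.toRingHom = eval P.rep :=
      MvPolynomial.ringHom_ext (fun r ↦ by simp) fun j ↦ by
        rw [hP, ← ha]
        simp [α, Units.smul_def]
    exact congrArg (fun f ↦ f s) this
  obtain ⟨p, q, hpq⟩ := Ideal.mem_span_pair.mp hsG
  have hpq' := congrArg α hpq
  rw [map_add, map_mul, map_mul, map_mul, hα hH, hα hK, hα hG] at hpq'
  refine ⟨α s * C (a : L) ^ d, ?_, Ideal.mem_span_pair.mpr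
    ⟨α p * C (a : L) ^ h, α q * C (a : L) ^ k, by linear_combination hpq'⟩⟩
  rw [map_mul, hαe, map_pow, eval_C]
  exact mul_ne_zero hs (pow_ne_zero _ a.ne_zero)

/-- The map from polynomials to the local ring of the intersection `V(H) ∩ V(K)` at `P`. -/
def toGermQuotient (H K : MvPolynomial (Fin 3) L) (P : ℙ L (Fin 3 → L)) :
    MvPolynomial (Fin 3) L →ₗ[L] PlaneLocalRing L ⧸ Ideal.span {germ H P, germ K P} :=
  ((Ideal.Quotient.mkₐ L _).comp ((IsScalarTower.toAlgHom L (MvPolynomial (Fin 2) L) _).comp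
    (dehom P.rep (chartIndex P)))).toLinearMap

theorem toGermQuotient_eq_zero_iff {H K G : MvPolynomial (Fin 3) L} {P : ℙ L (Fin 3 → L)} :
    toGermQuotient H K P G = 0 ↔ germ G P ∈ Ideal.span {germ H P, germ K P} :=
  Ideal.Quotient.eq_zero_iff_mem

/-- The lower bound in Bézout's theorem, for the sum of the local intersection numbers over
finitely many suitable points. -/
theorem exists_finset_mul_le_sum_rank [IsAlgClosed L] {H K : MvPolynomial (Fin 3) L} {h k : ℕ}
    (hH : H.IsHomogeneous h) (hK : K.IsHomogeneous k) (hH0 : H ≠ 0) (hK0 : K ≠ 0) :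
    ∃ s : Finset (ℙ L (Fin 3 → L)), ((h * k : ℕ) : ℕ∞) ≤ ∑ P ∈ s, Cardinal.toENat
      (Module.rank L (PlaneLocalRing L ⧸ Ideal.span {germ H P, germ K P})) := by
  obtain ⟨n₀, hn₀⟩ := exists_forall_mem_of_locally_mem (Ideal.span {H, K})
  let V := homogeneousSubmodule (Fin 3) L (h + k + n₀)
  have hV := mul_le_rank_homogeneous_quotient hH hK hH0 hK0 n₀
  obtain ⟨s, hs⟩ := exists_finset_toENat_rank_quotient_le
    (Q := fun P ↦ PlaneLocalRing L ⧸ Ideal.span {germ H P, germ K P})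
    (fun P ↦ toGermQuotient H K P ∘ₗ V.subtype)
    (((Ideal.span {H, K}).restrictScalars L).comap V.subtype) fun G hG ↦
      hn₀ (h + k + n₀) (Nat.le_add_left _ _) G.1 G.2
        (exists_mul_mem_of_germ_mem hH hK G.2 fun P ↦ toGermQuotient_eq_zero_iff.mp (hG P))
  exact ⟨s, hV.trans hs⟩

theorem sum_le_tsum_enat {ι : Type*} (f : ι → ℕ∞) (s : Finset ι) : ∑ i ∈ s, f i ≤ ∑' i, f i :=
  (hasSum_of_isLUB _ (isLUB_ciSup (OrderTop.bddAbove _))).summable.sum_le_tsum s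
    (fun _ _ ↦ zero_le)

/-- Coprime forms `H` and `K` contribute at least `deg H * deg K` to the total delta invariant of
the curve `V(H * K)`. -/
theorem mul_le_tsum_delta [IsAlgClosed L] {H K : MvPolynomial (Fin 3) L} {h k : ℕ}
    (hH : H.IsHomogeneous h) (hK : K.IsHomogeneous k) (hH0 : H ≠ 0) (hK0 : K ≠ 0)
    (hrel : IsRelPrime H K) : ((h * k : ℕ) : ℕ∞) ≤ ∑' P, delta (H * K) P := by
  obtain ⟨s, hs⟩ := exists_finset_mul_le_sum_rank hH hK hH0 hK0
  exact (hs.trans (Finset.sum_le_sum fun P _ ↦ toENat_rank_le_delta_mul hH hK hrel P)).trans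
    (sum_le_tsum_enat _ s)

theorem genus_add_mul_le [IsAlgClosed L] {H K : MvPolynomial (Fin 3) L} {f g : ℕ}
    (hHK : (H * K).IsHomogeneous f) (hsq : Squarefree (H * K))
    (hg : HasGeometricGenus (H * K) f g) :
    H.totalDegree + K.totalDegree = f ∧
      g + H.totalDegree * K.totalDegree ≤ (f - 1).choose 2 := by
  have h0 : H * K ≠ 0 := hsq.ne_zero
  have hH0 : H ≠ 0 := left_ne_zero_of_mul h0
  have hK0 : K ≠ 0 := right_ne_zero_of_mul h0
  have hH := isHomogeneous_of_mul_isHomogeneous hHK h0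
  have hK := isHomogeneous_of_mul_isHomogeneous (mul_comm H K ▸ hHK) (mul_comm H K ▸ h0)
  refine ⟨by rw [← totalDegree_mul_of_isDomain hH0 hK0, hHK.totalDegree h0], ?_⟩
  have hle := mul_le_tsum_delta hH hK hH0 hK0 (squarefree_mul_iff.mp hsq).1
  have hle' := add_le_add_right hle (g : ℕ∞)
  rw [HasGeometricGenus] at hg
  rw [hg] at hle'
  exact_mod_cast hle'

end Intersection

end

end PlaneCurve

theorem mainTheorem3 {k : Type*} {kbar : Type*} [Field k] [Field kbar] [Algebra k kbar]
    [IsAlgClosure k kbar] (f g : ℕ) (F : MvPolynomial (Fin 3) k)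
    (hF : F.IsHomogeneous f)
    (hred : Squarefree (F.map (algebraMap k kbar)))
    (hadm : ∀ P, PlaneCurve.IsSingularPoint (F.map (algebraMap k kbar)) P →
      PlaneCurve.IsAdmissible (F.map (algebraMap k kbar)) P)
    (hg : PlaneCurve.HasGeometricGenus (F.map (algebraMap k kbar)) f g)
    (H K : MvPolynomial (Fin 3) kbar)
    (hHK : F.map (algebraMap k kbar) = H * K)
    (hle : H.totalDegree ≤ K.totalDegree) :
    (5 ≤ f → f ≤ 10 → 4 ≤ g → g ≤ 14 →
      ∃ b, PlaneCurve.tableEntry f g = some b ∧ H.totalDegree ≤ b) ∧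
    (PlaneCurve.CaseOfInterest f g → H.totalDegree ≤ 2) := by
  have : IsAlgClosed kbar := IsAlgClosure.isAlgClosed k
  have hF' := hF.map (algebraMap k kbar)
  rw [hHK] at hF' hred hg
  obtain ⟨hdeg, hgenus⟩ := PlaneCurve.genus_add_mul_le hF' hred hg
  generalize H.totalDegree = a at *
  generalize K.totalDegree = b at *
  subst hdeg
  constructor
  · intro h5 h10 h4 h14
    have ha : a ≤ 5 := by omega
    have hb : b ≤ 10 := by omega
    -- Finitely many pairs of degrees remain, and for each pair `hgenus` bounds `g`.
    interval_cases a <;> interval_cases b <;>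
    first
      | omega
      | (simp only [Nat.choose] at hgenus
         interval_cases g <;> first | omega | simp [PlaneCurve.tableEntry, PlaneCurve.tableRow])
  · intro h
    by_contra! ha
    have hf : a + b ≤ 9 := by
      rcases h with h | h | h <;> omega
    have ha' : a ≤ 4 := by omega
    have hb' : b ≤ 9 := by omega
    unfold PlaneCurve.CaseOfInterest at h
    interval_cases a <;> interval_cases b <;> simp [Nat.choose] at hgenus <;> omega
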